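/- Let $\mathbb F_\omega$ be the free group on letters $a_0,a_1,\dots$. The space of marked groups $\mathscr G$ is the set of normal subgroups $N$ of $\mathbb F_\omega$ with the topology inherited from the Cantor space $2^{\mathbb F_\omega}$ (a Polish space); $N$ is identified with the group $\mathbb F_\omega/N$. Let $\mathscr G_{fg}=\bigcup_{m\ge 1}\{N\in\mathscr G : a_i\in N\text{ for all } i\ge m\}$ be the standard Borel space of finitely generated marked groups, whose Borel sets are the sets $B\cap\mathscr G_{fg}$ with $B\subseteq\mathscr G$ Borel. A group satisfies the maximal condition on normal subgroups (max-n) if it has no infinite strictly increasing chain of normal subgroups; let $\mathcal M_n\subseteq\mathscr G$ be the set of marked groups satisfying max-n. A subset of a standard Borel space $Y$ is $\Sigma^1_1$ if it is the projection to $Y$ of a Borel subset of $X\times Y$ for an uncountable standard Borel space $X$, and $\Pi^1_1$ if its complement is $\Sigma^1_1$. Given an enumeration (possibly with repetitions) $(\gamma_i)_{i\in\mathbb N}$ of $\mathbb F_\omega$ and a marked group $G=\mathbb F_\omega/N$, let $g_i$ be the image of $\gamma_i$ in $G$, and let $T_G$ be the tree of all finite sequences $(s_0,\dots,s_{k-1})$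 of natural numbers such that for each $j<k$ the normal closure of $\{g_{s_0},\dots,g_{s_j}\}$ in $G$ differs from that of $\{g_{s_0},\dots,g_{s_{j-1}}\}$. The length of $G$ is $\rho_{T_G}(\emptyset)+1$ if $T_G$ is well-founded, where $\rho_T(t)=\sup\{\rho_T(s)+1 : s\in T,\ t\subsetneq s\}$, and $\omega_1$ otherwise. **Theorem.** (i) $\mathcal M_n$ is $\Pi^1_1$ and not Borel in $\mathscr G$. (ii) $\mathcal M_n\cap\mathscr G_{fg}$ is $\Pi^1_1$ and not Borel in $\mathscr G_{fg}$. (iii) For every enumeration $(\gamma_i)$ of $\mathbb F_\omega$, every group in $\mathcal M_n$ has length less than $\omega_1$, and for each $\alpha<\omega_1$ there is a group in $\mathcal M_n\cap\mathscr G_{fg}$ of length at least $\alpha$. -/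

import Mathlib

/-- A marked group: a normal subgroup `ker` of the free group on the letters `a_0, a_1, …`,
identified with the group `FreeGroup ℕ ⧸ ker` marked by the images of the `a_i`. -/
@[ext]
structure MarkedGroup where
  ker : Subgroup (FreeGroup ℕ)
  normal : ker.Normal

namespace MarkedGroup

instance instNormalKer (N : MarkedGroup) : N.ker.Normal := N.normal

/-- The underlying group of a marked group. -/
abbrev Grp (N : MarkedGroup) : Type := FreeGroup ℕ ⧸ N.ker

open Classical in
/-- The indicator function of the normal subgroup, a point of the Cantor space. -/
noncomputable def indicator (N : MarkedGroup) : FreeGroup ℕ → Bool :=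
  fun g => decide (g ∈ N.ker)

/-- The topology inherited from the Cantor space `2 ^ FreeGroup ℕ`. -/
noncomputable instance instTopologicalSpace : TopologicalSpace MarkedGroup :=
  TopologicalSpace.induced indicator inferInstance

noncomputable instance instMeasurableSpace : MeasurableSpace MarkedGroup := borel MarkedGroup

instance instBorelSpace : BorelSpace MarkedGroup := ⟨rfl⟩

theorem indicator_injective : Function.Injective indicator := by
  intro M N h
  ext g
  have := congrFun h g
  simpa [indicator] using this

theorem isClosed_range_indicator : IsClosed (Set.range indicator) := by
  have h : Set.range indicator =
      {f : FreeGroup ℕ → Bool | f 1 = true} ∩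
      ((⋂ g, ⋂ k, {f | f g = true → f k = true → f (g * k) = true}) ∩
      ((⋂ g, {f | f g = true → f g⁻¹ = true}) ∩
      (⋂ g, ⋂ k, {f | f g = true → f (k * g * k⁻¹) = true}))) := by
    ext f
    simp only [Set.mem_range, Set.mem_inter_iff, Set.mem_iInter, Set.mem_ofPred_eq]
    constructor
    · rintro ⟨N, rfl⟩
      simp only [indicator, decide_eq_true_eq]
      exact ⟨N.ker.one_mem, fun _ _ => N.ker.mul_mem, fun _ => N.ker.inv_mem,
        fun g k hg => N.normal.conj_mem g hg k⟩
    · rintro ⟨h1, hm, hi, hc⟩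
      let K : Subgroup (FreeGroup ℕ) :=
        { carrier := {g | f g = true}
          one_mem' := h1
          mul_mem' := fun {a b} ha hb => hm a b ha hb
          inv_mem' := fun {a} ha => hi a ha }
      have hK (g : FreeGroup ℕ) : g ∈ K ↔ f g = true := Iff.rfl
      refine ⟨⟨K, ⟨fun g hg k => hc g k hg⟩⟩, ?_⟩
      funext g
      exact Bool.eq_iff_iff.mpr (by simp [indicator, hK])
  have ev (g : FreeGroup ℕ) : IsClopen {f : FreeGroup ℕ → Bool | f g = true} :=
    (isClopen_discrete {true}).preimage (continuous_apply g)
  have imp {p q : (FreeGroup ℕ → Bool) → Prop} (hp : IsOpen {f | p f})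
      (hq : IsClosed {f | q f}) : IsClosed {f | p f → q f} := isClosed_imp hp hq
  rw [h]
  exact (ev 1).1.inter ((isClosed_iInter fun g => isClosed_iInter fun k =>
    imp (ev g).2 (imp (ev k).2 (ev (g * k)).1)).inter
    ((isClosed_iInter fun g => imp (ev g).2 (ev g⁻¹).1).inter
    (isClosed_iInter fun g => isClosed_iInter fun k => imp (ev g).2 (ev (k * g * k⁻¹)).1)))

/-- The space of marked groups is a Polish space. -/
instance instPolishSpace : PolishSpace MarkedGroup := by
  have : Countable (FreeGroup ℕ) := Quot.mk_surjective.countable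
  have : PolishSpace (FreeGroup ℕ → Bool) := { }
  have h : Topology.IsClosedEmbedding indicator :=
    ⟨⟨⟨rfl⟩, indicator_injective⟩, isClosed_range_indicator⟩
  exact h.polishSpace

/-- The `m`-generated marked groups: `a_i` is trivial for all `i ≥ m`. -/
def generatedBy (m : ℕ) : Set MarkedGroup :=
  {N | ∀ i, m ≤ i → FreeGroup.of i ∈ N.ker}

/-- The space of finitely generated marked groups. As a subtype it carries the Borel structure
whose Borel sets are the traces of the Borel sets of `MarkedGroup`. -/
def fg : Set MarkedGroup := ⋃ m ≥ 1, generatedBy m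

theorem measurableSet_fg : MeasurableSet fg := by
  refine MeasurableSet.iUnion fun m => MeasurableSet.iUnion fun _ => IsClosed.measurableSet ?_
  have h : generatedBy m = ⋂ i, ⋂ (_ : m ≤ i), {N | indicator N (FreeGroup.of i) = true} := by
    ext N
    simp [generatedBy, indicator]
  rw [h]
  exact isClosed_iInter fun i => isClosed_iInter fun _ =>
    (isClosed_discrete {true}).preimage
      ((continuous_apply (FreeGroup.of i)).comp (continuous_induced_dom (f := indicator)))

/-- The space of finitely generated marked groups is a standard Borel space. -/
instance instStandardBorelSpaceFg : StandardBorelSpace fg := measurableSet_fg.standardBorel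

end MarkedGroup

/-- The maximal condition on normal subgroups: there is no infinite strictly increasing chain of
normal subgroups. -/
def MaxN (G : Type*) [Group G] : Prop :=
  ¬ ∃ K : ℕ → Subgroup G, (∀ n, (K n).Normal) ∧ StrictMono K

/-- The set of marked groups satisfying max-n. -/
def maxNGroups : Set MarkedGroup := {N | MaxN N.Grp}

/-- The finitely generated marked groups satisfying max-n, as a subset of the space of finitely
generated marked groups. -/
def maxNGroupsFg : Set MarkedGroup.fg := {N | (N : MarkedGroup) ∈ maxNGroups}

/-- A subset of a standard Borel space is analytic (`Σ¹₁`) if it is the projection of a Borel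
subset of its product with an uncountable standard Borel space; as all uncountable standard Borel
spaces are isomorphic, the latter can be taken to be the Baire space. -/
def IsSigma11 {Y : Type*} [MeasurableSpace Y] [StandardBorelSpace Y] (A : Set Y) : Prop :=
  ∃ B : Set ((ℕ → ℕ) × Y), MeasurableSet B ∧ Prod.snd '' B = A

/-- A subset of a standard Borel space is co-analytic (`Π¹₁`) if its complement is analytic. -/
def IsPi11 {Y : Type*} [MeasurableSpace Y] [StandardBorelSpace Y] (A : Set Y) : Prop :=
  IsSigma11 Aᶜ

/-- `s` is a proper extension of `t` in `T`. -/
def TreeExtends (T : Set (List ℕ)) (s t : List ℕ) : Prop :=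
  s ∈ T ∧ t ∈ T ∧ t <+: s ∧ t ≠ s

open Classical in
/-- The rank of a tree `T` of finite sequences: `0` if `T` is empty; `ρ_T(∅) + 1` if `T` is
nonempty and well-founded, where `ρ_T(t) = sup {ρ_T(s) + 1 | s ∈ T properly extends t}`; and `ω₁`
if `T` is not well-founded. -/
noncomputable def treeRank (T : Set (List ℕ)) : Ordinal.{0} :=
  if T = ∅ then 0
  else if h : WellFounded (TreeExtends T) then (h.apply []).rank + 1
  else Ordinal.omega 1

/-- The tree of a marked group `G`, enumerated by the images `g_i` of the terms of an enumeration
`γ` of the free group: a sequence lies in the tree if and only if, for each of its nonempty initial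
segments `(v, i)`, the element `g_i` enlarges the normal closure of `{g_j | j ∈ v}`. -/
def normalClosureTree (γ : ℕ → FreeGroup ℕ) (N : MarkedGroup) : Set (List ℕ) :=
  {s | ∀ (v : List ℕ) (i : ℕ), v ++ [i] <+: s →
    Subgroup.normalClosure ({g : N.Grp | ∃ j ∈ v, (γ j : N.Grp) = g} ∪ {(γ i : N.Grp)}) ≠
      Subgroup.normalClosure {g : N.Grp | ∃ j ∈ v, (γ j : N.Grp) = g}}

/-- The length of a marked group: the rank of its tree. -/
noncomputable def MarkedGroup.length (γ : ℕ → FreeGroup ℕ) (N : MarkedGroup) : Ordinal.{0} :=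
  treeRank (normalClosureTree γ N)

open MeasureTheory Filter Topology

/-! Failure of max-n is witnessed by a sequence of normal subgroups, a point of a Polish space, so
max-n is Π¹₁. Both non-Borel claims and the long lengths follow from
`not_measurableSet_maxNGroups_inter_fg`. If that set were Borel, a relation would be well-founded
iff it maps, order reversed, into the normal subgroups of some group in the set, and
well-foundedness would be analytic, against `not_analyticSet_wellFounded`.

This needs finitely generated max-n groups with long descending families of normal subgroups
(`exists_maxN_of_wellFounded`). Let W be a countable well-order with least element ⊥, let q : ℕ → W
take every value infinitely often, and let S = A₅. Mark in row c of W × ℤ the sums of powers 3 ^ n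
over finite sets of exponents along which q increases strictly, with values between ⊥ and c. Powers
of 3 are so sparse that near 3 ^ n row c copies row q n near 0 whenever q n < c. In S^(W × ℤ) ⋊ ℤ
take the group generated by the translation, the constants, and the functions constant on the marked
set and trivial off it. Its elements are local rules, and commutators in the nonabelian simple group
S give Boolean operations on supports. Hence a normal subgroup containing a configuration nontrivial
in row c₀ contains every configuration trivial below c₀ (`inl_mem_of_trivial_below`). Max-n follows
since W is well-ordered and ℤ is Noetherian, while the subgroups trivial up to row w strictly
decrease in w.

For lengths, the tree is well-founded iff max-n holds, and "rank at most α" is a Borel condition for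
countable α, so bounded lengths would make the set Borel. -/

/-! ### Analytic sets, and max-n is co-analytic. -/

theorem MeasureTheory.AnalyticSet.isSigma11 {Y : Type*} [TopologicalSpace Y] [PolishSpace Y]
    [MeasurableSpace Y] [BorelSpace Y] {A : Set Y} (hA : AnalyticSet A) : IsSigma11 A := by
  rw [AnalyticSet] at hA
  rcases hA with rfl | ⟨f, hf, rfl⟩
  · exact ⟨∅, MeasurableSet.empty, by simp⟩
  · refine ⟨{p | f p.1 = p.2}, measurableSet_eq_fun (hf.measurable.comp measurable_fst)
      measurable_snd, ?_⟩
    ext y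
    constructor
    · rintro ⟨⟨x, _⟩, h, rfl⟩
      exact ⟨x, h⟩
    · rintro ⟨x, rfl⟩
      exact ⟨(x, f x), rfl, rfl⟩

theorem IsSigma11.preimage {Y Z : Type*} [MeasurableSpace Y] [StandardBorelSpace Y]
    [MeasurableSpace Z] [StandardBorelSpace Z] {A : Set Y} (hA : IsSigma11 A) {f : Z → Y}
    (hf : Measurable f) : IsSigma11 (f ⁻¹' A) := by
  obtain ⟨B, hB, rfl⟩ := hA
  refine ⟨{p | (p.1, f p.2) ∈ B},
    (measurable_fst.prodMk (hf.comp measurable_snd)) hB, ?_⟩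
  ext z
  constructor
  · rintro ⟨⟨x, _⟩, h, rfl⟩
    exact ⟨_, h, rfl⟩
  · rintro ⟨⟨x, y⟩, h, hy⟩
    exact ⟨(x, z), by simpa [← hy] using h, rfl⟩

namespace MarkedGroup

theorem measurableSet_mem_ker (g : FreeGroup ℕ) : MeasurableSet {N : MarkedGroup | g ∈ N.ker} := by
  have h : {N : MarkedGroup | g ∈ N.ker} = {N | indicator N g = true} := by
    ext N
    simp [indicator]
  rw [h]
  exact ((isClosed_discrete {true}).preimage
    ((continuous_apply g).comp (continuous_induced_dom (f := indicator)))).measurableSet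

instance : Countable (FreeGroup ℕ) := Quot.mk_surjective.countable

theorem measurableSet_ker_le {X : Type*} [MeasurableSpace X] {f g : X → MarkedGroup}
    (hf : Measurable f) (hg : Measurable g) : MeasurableSet {x | (f x).ker ≤ (g x).ker} := by
  have h : {x | (f x).ker ≤ (g x).ker} =
      ⋂ w, ({x | w ∈ (f x).ker}ᶜ ∪ {x | w ∈ (g x).ker}) := by
    ext x
    simp [SetLike.le_def, imp_iff_not_or]
  rw [h]
  exact MeasurableSet.iInter fun w => (hf (measurableSet_mem_ker w)).compl.union
    (hg (measurableSet_mem_ker w))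

theorem measurableSet_ker_lt {X : Type*} [MeasurableSpace X] {f g : X → MarkedGroup}
    (hf : Measurable f) (hg : Measurable g) : MeasurableSet {x | (f x).ker < (g x).ker} := by
  simp only [lt_iff_le_not_ge]
  exact (measurableSet_ker_le hf hg).inter (measurableSet_ker_le hg hf).compl

/-- Max-n in terms of chains of normal subgroups of the free group. -/
theorem mem_maxNGroups_iff {N : MarkedGroup} : N ∈ maxNGroups ↔
    ¬ ∃ K : ℕ → MarkedGroup, (∀ n, N.ker ≤ (K n).ker) ∧ ∀ n, (K n).ker < (K (n + 1)).ker := by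
  have hs := QuotientGroup.mk'_surjective N.ker
  refine not_congr ⟨?_, ?_⟩
  · rintro ⟨K, hK, hmono⟩
    refine ⟨fun n => ⟨(K n).comap (QuotientGroup.mk' N.ker), (hK n).comap _⟩, fun n => ?_,
      fun n => ?_⟩
    · intro x hx
      have : QuotientGroup.mk' N.ker x = 1 := (QuotientGroup.eq_one_iff x).2 hx
      simp only [Subgroup.mem_comap, this]
      exact one_mem _
    · exact (Subgroup.comap_lt_comap_of_surjective hs).2 (hmono n.lt_succ_self)
  · rintro ⟨K, hN, hK⟩
    refine ⟨fun n => (K n).ker.map (QuotientGroup.mk' N.ker),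
      fun n => (K n).normal.map _ hs, strictMono_nat_of_lt_succ fun n => ?_⟩
    rw [← Subgroup.comap_lt_comap_of_surjective hs]
    have h (n) : ((K n).ker.map (QuotientGroup.mk' N.ker)).comap (QuotientGroup.mk' N.ker) =
        (K n).ker := by
      rw [Subgroup.comap_map_eq, QuotientGroup.ker_mk', sup_eq_left]
      exact hN n
    rw [h, h]
    exact hK n

theorem analyticSet_compl_maxNGroups : AnalyticSet maxNGroupsᶜ := by
  have h : maxNGroupsᶜ = Prod.fst '' {p : MarkedGroup × (ℕ → MarkedGroup) |
      (∀ n, p.1.ker ≤ (p.2 n).ker) ∧ ∀ n, (p.2 n).ker < (p.2 (n + 1)).ker} := by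
    ext N
    simp [mem_maxNGroups_iff]
  rw [h]
  refine AnalyticSet.image_of_continuous (MeasurableSet.analyticSet ?_) continuous_fst
  have hm (n : ℕ) : Measurable fun p : MarkedGroup × (ℕ → MarkedGroup) => p.2 n :=
    (measurable_pi_apply n).comp measurable_snd
  simp only [Set.ofPred_and, Set.ofPred_forall]
  exact (MeasurableSet.iInter fun n => measurableSet_ker_le measurable_fst (hm n)).inter
    (MeasurableSet.iInter fun n => measurableSet_ker_lt (hm n) (hm (n + 1)))

end MarkedGroup

/-! ### Well-foundedness is not analytic: a diagonal argument. -/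

/-- The initial segment of length `n` of a sequence. -/
def initSeg {α : Type*} (x : ℕ → α) (n : ℕ) : List α := (List.range n).map x

theorem initSeg_eq_iff {α : Type*} {x y : ℕ → α} {n : ℕ} :
    initSeg x n = initSeg y n ↔ ∀ i < n, x i = y i := by
  simp [initSeg]

theorem dropLast_initSeg {α : Type*} (x : ℕ → α) (n : ℕ) :
    (initSeg x (n + 1)).dropLast = initSeg x n := by
  simp [initSeg, List.range_succ]

/-- The relation on finite sequences coded by `x`, evaluated along `x` itself. -/
def diagRel (x : ℕ → Bool) (p : List ℕ × List ℕ) : Bool :=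
  decide (p.1.dropLast = p.2 ∧ p.1 ≠ []) &&
    x (Encodable.encode (initSeg x p.1.length, p.1))

theorem continuous_diagRel : Continuous diagRel := by
  refine continuous_pi fun p => Continuous.comp (g := fun b => _ && b)
    continuous_of_discreteTopology (IsLocallyConstant.continuous ?_)
  rw [IsLocallyConstant.iff_eventually_eq]
  intro x
  have ev (i : ℕ) : ∀ᶠ y : ℕ → Bool in 𝓝 x, y i = x i :=
    (continuous_apply i).continuousAt.eventually_mem ((isOpen_discrete {x i}).mem_nhds rfl)
  have h1 : ∀ᶠ y : ℕ → Bool in 𝓝 x, ∀ i ∈ Finset.range p.1.length, y i = x i :=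
    (Filter.eventually_all_finset _).2 fun i _ => ev i
  filter_upwards [h1, ev (Encodable.encode (initSeg x p.1.length, p.1))] with y hy hy'
  have : initSeg y p.1.length = initSeg x p.1.length :=
    initSeg_eq_iff.2 fun i hi => hy i (Finset.mem_range.2 hi)
  rw [this, hy']

open Classical in
/-- A code for the range of `f`: pairs of initial segments of points of the graph of `f`. -/
noncomputable def rangeCode (f : (ℕ → ℕ) → ℕ → Bool) (i : ℕ) : Bool :=
  decide (∃ y n, i = Encodable.encode (initSeg (f y) n, initSeg y n))

/-- For continuous f, an infinite branch of this relation yields a point y with f y = `rangeCode f`,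
and conversely. So the relation is ill-founded exactly when the code lies in the range of f. -/
theorem diagRel_rangeCode {f : (ℕ → ℕ) → ℕ → Bool} {s t : List ℕ} :
    diagRel (rangeCode f) (t, s) = true ↔ t.dropLast = s ∧ t ≠ [] ∧
      ∃ y, initSeg (f y) t.length = initSeg (rangeCode f) t.length ∧ initSeg y t.length = t := by
  have hlen {α} (y : ℕ → α) (n) : (initSeg y n).length = n := by simp [initSeg]
  simp only [diagRel, Bool.and_eq_true, decide_eq_true_eq, and_assoc]
  refine and_congr_right fun _ => and_congr_right fun _ => ?_
  simp only [rangeCode, decide_eq_true_eq]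
  constructor
  · rintro ⟨y, n, h⟩
    obtain ⟨h1, h2⟩ := Prod.ext_iff.1 (Encodable.encode_injective h)
    simp only at h1 h2
    have : t.length = n := by rw [h2, hlen]
    exact ⟨y, by rw [this] at h1 ⊢; exact h1.symm, by rw [this]; exact h2.symm⟩
  · rintro ⟨y, h1, h2⟩
    exact ⟨y, t.length, by rw [h1, h2]⟩

/-- The set of well-founded relations is not analytic. -/
theorem not_analyticSet_wellFounded : ¬ AnalyticSet
    {R : List ℕ × List ℕ → Bool | WellFounded fun s t => R (s, t) = true} := by
  intro hWF
  have : PolishSpace (ℕ → Bool) := { }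
  have hA := hWF.preimage continuous_diagRel
  rw [AnalyticSet] at hA
  rcases hA with hA | ⟨f, hf, hA⟩
  -- The preimage is not empty, since the empty relation is well-founded.
  · have : (fun _ => false) ∈ diagRel ⁻¹'
        {R : List ℕ × List ℕ → Bool | WellFounded fun s t => R (s, t) = true} :=
      ⟨fun a => ⟨a, fun b hb => by simp [diagRel] at hb⟩⟩
    rw [hA] at this
    exact this
  · have hlen {α} (y : ℕ → α) (n) : (initSeg y n).length = n := by simp [initSeg]
    by_cases hz : rangeCode f ∈ Set.range f
    · have hwf := hA ▸ hz
      obtain ⟨y, hy⟩ := hz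
      refine (wellFounded_iff_isEmpty_descending_chain.1 hwf).elim ⟨initSeg y, fun n => ?_⟩
      rw [diagRel_rangeCode]
      refine ⟨dropLast_initSeg y n, by simp [initSeg, List.range_succ],
        y, by rw [hy], by rw [hlen]⟩
    · have hwf := hA ▸ hz
      apply hz
      simp only [Set.mem_preimage, Set.mem_ofPred_eq,
        wellFounded_iff_isEmpty_descending_chain, not_isEmpty_iff] at hwf
      obtain ⟨s, hs⟩ := hwf
      simp only [diagRel_rangeCode] at hs
      choose hs1 hs2 y hy1 hy2 using hs
      have hl (n) : (s n).length = (s 0).length + n := by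
        induction n with
        | zero => rfl
        | succ n ih =>
          have := congrArg List.length (hs1 n)
          have h2 := List.length_pos_iff.2 (hs2 n)
          simp only [List.length_dropLast] at this
          omega
      -- The nodes of the chain extend one another, so their witnesses y n converge; continuity of f
      -- then puts the code in the range.
      have hcoh (n i) (hi : i ≤ n) : y n i = y i i := by
        induction n, hi using Nat.le_induction with
        | base => rfl
        | succ n hn ih =>
          rw [← ih]
          have h1 := hy2 (n + 1)
          have h2 := hy2 n
          rw [hl] at h1 h2
          rw [← hs1 (n + 1), ← h1] at h2
          rw [show (s 0).length + (n + 1 + 1) = (s 0).length + n + 1 + 1 by omega,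
            dropLast_initSeg] at h2
          exact (initSeg_eq_iff.1 h2 i (by omega)).symm
      have hlim : Tendsto y atTop (𝓝 fun i => y i i) :=
        tendsto_pi_nhds.2 fun i => tendsto_const_nhds.congr'
          (eventually_atTop.2 ⟨i, fun n hn => (hcoh n i hn).symm⟩)
      have hlim2 : Tendsto (fun n => f (y n)) atTop (𝓝 (rangeCode f)) :=
        tendsto_pi_nhds.2 fun i => tendsto_const_nhds.congr'
          (eventually_atTop.2 ⟨i, fun n hn =>
            (initSeg_eq_iff.1 (hy1 n) i (by rw [hl]; omega)).symm⟩)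
      exact ⟨_, tendsto_nhds_unique ((hf.tendsto _).comp hlim) hlim2⟩

/-! ### The tree of normal closures and max-n. -/

namespace MarkedGroup

/-- The normal closure in a marked group of the images of the terms of `γ` listed in `v`. -/
def listClosure (γ : ℕ → FreeGroup ℕ) (N : MarkedGroup) (v : List ℕ) : Subgroup N.Grp :=
  Subgroup.normalClosure {g : N.Grp | ∃ j ∈ v, (γ j : N.Grp) = g}

instance (γ : ℕ → FreeGroup ℕ) (N : MarkedGroup) (v : List ℕ) : (listClosure γ N v).Normal :=
  Subgroup.normalClosure_normal

theorem listClosure_le {γ : ℕ → FreeGroup ℕ} {N : MarkedGroup} {v : List ℕ}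
    {H : Subgroup N.Grp} [H.Normal] (h : ∀ j ∈ v, (γ j : N.Grp) ∈ H) : listClosure γ N v ≤ H := by
  refine Subgroup.normalClosure_le_normal ?_
  rintro _ ⟨j, hj, rfl⟩
  exact h j hj

theorem mem_listClosure (γ : ℕ → FreeGroup ℕ) (N : MarkedGroup) {v : List ℕ} {j : ℕ} (hj : j ∈ v) :
    (γ j : N.Grp) ∈ listClosure γ N v :=
  Subgroup.subset_normalClosure ⟨j, hj, rfl⟩

theorem mem_normalClosureTree {γ : ℕ → FreeGroup ℕ} {N : MarkedGroup} {s : List ℕ} :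
    s ∈ normalClosureTree γ N ↔
      ∀ v i, v ++ [i] <+: s → (γ i : N.Grp) ∉ listClosure γ N v := by
  refine forall_congr' fun v => forall_congr' fun i => imp_congr_right fun _ => not_congr ?_
  constructor
  · intro h
    rw [listClosure, ← h]
    exact Subgroup.subset_normalClosure (Or.inr rfl)
  · intro h
    refine le_antisymm (Subgroup.normalClosure_le_normal ?_)
      (Subgroup.normalClosure_mono Set.subset_union_left)
    exact Set.union_subset Subgroup.subset_normalClosure (Set.singleton_subset_iff.2 h)

theorem nil_mem_normalClosureTree (γ : ℕ → FreeGroup ℕ) (N : MarkedGroup) :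
    [] ∈ normalClosureTree γ N := by
  simp [mem_normalClosureTree]

/-- Moving the closure to the free group turns membership into a countable union of conditions on
`N.ker`, hence a Borel condition. -/
theorem mem_listClosure_iff {γ : ℕ → FreeGroup ℕ} {N : MarkedGroup} {v : List ℕ}
    {g : FreeGroup ℕ} : (g : N.Grp) ∈ listClosure γ N v ↔
      ∃ h ∈ Subgroup.normalClosure {g | ∃ j ∈ v, γ j = g}, h⁻¹ * g ∈ N.ker := by
  have h : listClosure γ N v =
      (Subgroup.normalClosure {g | ∃ j ∈ v, γ j = g}).map (QuotientGroup.mk' N.ker) := by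
    rw [Subgroup.map_normalClosure _ _ (QuotientGroup.mk'_surjective _), listClosure]
    congr 1
    ext x
    simp
  simp [h, Subgroup.mem_map, ← QuotientGroup.eq]

theorem measurableSet_mem_normalClosureTree (γ : ℕ → FreeGroup ℕ) (s : List ℕ) :
    MeasurableSet {N | s ∈ normalClosureTree γ N} := by
  have hm (v : List ℕ) (g : FreeGroup ℕ) :
      MeasurableSet {N : MarkedGroup | (g : N.Grp) ∈ listClosure γ N v} := by
    simp only [mem_listClosure_iff, Set.ofPred_exists, Set.ofPred_and]
    exact MeasurableSet.iUnion fun h => (MeasurableSet.const _).inter (measurableSet_mem_ker _)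
  simp only [mem_normalClosureTree, imp_iff_not_or, Set.ofPred_forall (ι := ℕ),
    Set.ofPred_forall (ι := List ℕ), Set.ofPred_or]
  exact MeasurableSet.iInter fun v => MeasurableSet.iInter fun i =>
    (MeasurableSet.const _).union (hm v _).compl

/-- Closures increase strictly along a descending chain of `TreeExtends`. Conversely, choosing an
element of K (n + 1) outside K n for every n gives a branch. -/
theorem wellFounded_treeExtends_iff {γ : ℕ → FreeGroup ℕ} (hγ : Function.Surjective γ)
    {N : MarkedGroup} : WellFounded (TreeExtends (normalClosureTree γ N)) ↔ N ∈ maxNGroups := by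
  rw [wellFounded_iff_isEmpty_descending_chain, ← not_nonempty_iff]
  refine not_congr ⟨?_, ?_⟩
  · rintro ⟨s, hs⟩
    refine ⟨fun n => listClosure γ N (s n), fun n => inferInstance,
      strictMono_nat_of_lt_succ fun n => ?_⟩
    obtain ⟨h1, -, ⟨u, hu⟩, hne⟩ := hs n
    refine lt_of_le_of_ne (listClosure_le fun j hj => mem_listClosure γ N ?_) fun h => ?_
    · rw [← hu]
      exact List.mem_append_left _ hj
    · cases u with
      | nil => exact hne (by simpa using hu)
      | cons i u =>
        refine mem_normalClosureTree.1 h1 (s n) i ⟨u, by simpa using hu⟩ ?_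
        rw [h]
        exact mem_listClosure γ N (by simp [← hu])
  · rintro ⟨K, hK, hmono⟩
    have hex (n : ℕ) : ∃ i, (γ i : N.Grp) ∈ K (n + 1) ∧ (γ i : N.Grp) ∉ K n := by
      obtain ⟨x, hx, hx'⟩ := SetLike.exists_of_lt (show K n < K (n + 1) from hmono n.lt_succ_self)
      obtain ⟨g, rfl⟩ := QuotientGroup.mk_surjective x
      obtain ⟨i, rfl⟩ := hγ g
      exact ⟨i, hx, hx'⟩
    choose y hy hy' using hex
    have hT (n : ℕ) : initSeg y n ∈ normalClosureTree γ N := by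
      rw [mem_normalClosureTree]
      rintro v i hvi hmem
      have hlen : v.length < n := by
        have h1 := List.IsPrefix.length_le hvi
        simp only [initSeg, List.length_append, List.length_singleton, List.length_map,
          List.length_range] at h1
        omega
      have hv : v ++ [i] = initSeg y (v.length + 1) := by
        have h1 := List.prefix_iff_eq_take.1 hvi
        rw [h1, initSeg, ← List.map_take, List.take_range, initSeg]
        simp [Nat.min_eq_left (show v.length + 1 ≤ n by omega)]
      have hi : v = initSeg y v.length ∧ i = y v.length := by
        rw [initSeg, List.range_succ, List.map_append] at hv
        simpa [initSeg] using List.append_inj hv (by simp)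
      refine hy' v.length ?_
      rw [← hi.2]
      have := hK v.length
      refine listClosure_le (fun j hj => ?_) hmem
      rw [hi.1, initSeg] at hj
      obtain ⟨m, hm, rfl⟩ := List.mem_map.1 hj
      exact hmono.monotone (Nat.succ_le_of_lt (List.mem_range.1 hm)) (hy m)
    refine ⟨initSeg y, fun n => ⟨hT _, hT _, ?_, fun h => ?_⟩⟩
    · exact ⟨[y n], by simp [initSeg, List.range_succ]⟩
    · simpa [initSeg] using congrArg List.length h

end MarkedGroup

/-! ### Countable ranks and the boundedness argument. -/

theorem Acc.rank_lt_omega_one {α : Type} [Countable α] {r : α → α → Prop} {a : α} (h : Acc r a) :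
    h.rank < Ordinal.omega 1 := by
  induction h with
  | intro a ha ih =>
    rw [Acc.rank_eq]
    exact Ordinal.iSup_lt_omega_one fun b =>
      (Cardinal.isSuccLimit_omega 1).succ_lt (ih b.1 b.2)

/-- `RankLE T s β` says that the rank of `s` in the tree `T` is at most `β`. -/
def RankLE (T : Set (List ℕ)) (s : List ℕ) (β : Ordinal.{0}) : Prop :=
  ∀ t, TreeExtends T t s → ∃ β' : Set.Iio β, RankLE T t β'
termination_by β
decreasing_by exact β'.2

theorem rankLE_iff {T : Set (List ℕ)} {s : List ℕ} {β : Ordinal.{0}} :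
    RankLE T s β ↔ ∀ t, TreeExtends T t s → ∃ β' : Set.Iio β, RankLE T t β' := by
  rw [RankLE]

theorem RankLE.acc {T : Set (List ℕ)} {s : List ℕ} {β : Ordinal.{0}} (h : RankLE T s β) :
    Acc (TreeExtends T) s := by
  induction β using WellFoundedLT.induction generalizing s with
  | ind β ih =>
    refine ⟨s, fun t ht => ?_⟩
    obtain ⟨β', hβ'⟩ := rankLE_iff.1 h t ht
    exact ih β' β'.2 hβ'

theorem rankLE_of_rank_le {T : Set (List ℕ)} {s : List ℕ} (h : Acc (TreeExtends T) s)
    {β : Ordinal.{0}} (hβ : h.rank ≤ β) : RankLE T s β := by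
  induction h generalizing β with
  | intro s hs ih =>
    refine rankLE_iff.2 fun t ht => ?_
    exact ⟨⟨(hs t ht).rank, (Acc.rank_lt_of_rel _ ht).trans_le hβ⟩, ih t ht le_rfl⟩

theorem RankLE.wellFounded {T : Set (List ℕ)} {β : Ordinal.{0}} (h : RankLE T [] β)
    (hT : [] ∈ T) : WellFounded (TreeExtends T) := by
  refine ⟨fun s => ?_⟩
  by_cases hs : s ∈ T
  · rcases eq_or_ne s [] with rfl | hne
    · exact h.acc
    · exact h.acc.inv ⟨hs, hT, List.nil_prefix, hne.symm⟩
  · exact ⟨s, fun t ht => absurd ht.2.1 hs⟩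

namespace MarkedGroup

/-- The recursion defining `RankLE` presupposes no well-foundedness and, below a countable β, uses
only countable unions and intersections. -/
theorem measurableSet_rankLE (γ : ℕ → FreeGroup ℕ) {β : Ordinal.{0}} (hβ : β < Ordinal.omega 1)
    (s : List ℕ) : MeasurableSet {N | RankLE (normalClosureTree γ N) s β} := by
  induction β using WellFoundedLT.induction generalizing s with
  | ind β ih =>
    have : Countable (Set.Iio β) := by
      rw [← Cardinal.mk_le_aleph0_iff, Cardinal.mk_Iio_ordinal, Cardinal.lift_le_aleph0,
        ← Cardinal.lt_aleph_one_iff, ← Cardinal.lt_ord, Cardinal.ord_aleph]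
      exact hβ
    simp only [rankLE_iff (β := β), Set.ofPred_forall, imp_iff_not_or, Set.ofPred_or,
      Set.ofPred_exists]
    refine MeasurableSet.iInter fun t => MeasurableSet.union (MeasurableSet.compl ?_)
      (MeasurableSet.iUnion fun β' => ih β' β'.2 (lt_trans β'.2 hβ) t)
    exact (measurableSet_mem_normalClosureTree γ t).inter
      ((measurableSet_mem_normalClosureTree γ s).inter (MeasurableSet.const _))

theorem length_lt_omega_one {γ : ℕ → FreeGroup ℕ} (hγ : Function.Surjective γ)
    {N : MarkedGroup} (hN : N ∈ maxNGroups) : length γ N < Ordinal.omega 1 := by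
  have hwf := (wellFounded_treeExtends_iff hγ).2 hN
  have hne : normalClosureTree γ N ≠ ∅ :=
    (Set.nonempty_of_mem (nil_mem_normalClosureTree γ N)).ne_empty
  rw [length, treeRank, if_neg hne, dif_pos hwf]
  exact (Cardinal.isSuccLimit_omega 1).add_one_lt (Acc.rank_lt_omega_one _)

/-- If α bounded all lengths, the set would coincide within `fg` with the Borel condition that the
root has rank at most α. -/
theorem exists_le_length {γ : ℕ → FreeGroup ℕ} (hγ : Function.Surjective γ)
    (hM : ¬ MeasurableSet (maxNGroups ∩ fg)) {α : Ordinal.{0}} (hα : α < Ordinal.omega 1) :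
    ∃ N ∈ maxNGroups ∩ fg, α ≤ length γ N := by
  by_contra! h
  apply hM
  have heq : maxNGroups ∩ fg = {N | RankLE (normalClosureTree γ N) [] α} ∩ fg := by
    refine Set.ext fun N => ⟨fun hN => ⟨?_, hN.2⟩, fun hN => ⟨?_, hN.2⟩⟩
    · have hwf := (wellFounded_treeExtends_iff hγ).2 hN.1
      have hne : normalClosureTree γ N ≠ ∅ :=
        (Set.nonempty_of_mem (nil_mem_normalClosureTree γ N)).ne_empty
      have hlt := h N hN
      rw [length, treeRank, if_neg hne, dif_pos hwf] at hlt
      exact rankLE_of_rank_le (hwf.apply []) (le_self_add.trans hlt.le)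
    · exact (wellFounded_treeExtends_iff hγ).1
        (RankLE.wellFounded hN.1 (nil_mem_normalClosureTree γ N))
  rw [heq]
  exact (measurableSet_rankLE γ hα []).inter measurableSet_fg

end MarkedGroup

/-! ### Self-similarity of chain sums. -/

/-- `ChainSum q c k` says that `k` is a sum of powers `3 ^ n` for `n` in a finite set on which `q` is
strictly increasing, with values strictly between `⊥` and `c`, where `c ≠ ⊥`. -/
inductive ChainSum {W : Type*} [LinearOrder W] [OrderBot W] (q : ℕ → W) : W → ℤ → Prop
  | zero {c : W} : ⊥ < c → ChainSum q c 0
  | step {c : W} {n : ℕ} {k : ℤ} : q n < c → ChainSum q (q n) k → 2 * k < 3 ^ n →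
      ChainSum q c (3 ^ n + k)

namespace ChainSum

variable {W : Type*} [LinearOrder W] [OrderBot W] {q : ℕ → W} {c d : W} {k : ℤ}

theorem bot_lt (h : ChainSum q c k) : ⊥ < c := by
  cases h with
  | zero h => exact h
  | step h _ _ => exact bot_le.trans_lt h

theorem nonneg (h : ChainSum q c k) : 0 ≤ k := by
  induction h with
  | zero _ => exact le_rfl
  | step _ _ _ ih => positivity

theorem pow_le_of_lt {m n : ℕ} (h : m < n) : 3 * 3 ^ m ≤ (3 : ℤ) ^ n := by
  rw [← pow_succ']
  exact pow_le_pow_right₀ (by norm_num) h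

/-- The ternary digits are 0 and 1, so a sum below 3 ^ n is at most 1 + 3 + ⋯ + 3 ^ (n - 1). -/
theorem two_mul_lt (h : ChainSum q c k) {n : ℕ} (hk : k < 3 ^ n) : 2 * k < 3 ^ n := by
  cases h with
  | zero _ => positivity
  | @step _ m k' _ hk' h2 =>
    have := hk'.nonneg
    have hmn : m < n := by
      by_contra! hnm
      have : (3 : ℤ) ^ n ≤ 3 ^ m := pow_le_pow_right₀ (by norm_num) hnm
      omega
    have := pow_le_of_lt hmn
    omega

/-- Near `3 ^ n`, the chain sums below `c` look like those below `q n` if `q n < c`. -/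
theorem pow_add_iff {n : ℕ} (h1 : -3 ^ n < 2 * k) (h2 : k < 3 ^ n) :
    ChainSum q c (3 ^ n + k) ↔ q n < c ∧ ChainSum q (q n) k := by
  constructor
  · intro h
    generalize hx : 3 ^ n + k = x at h
    cases h with
    | zero _ => omega
    | @step _ m k' hq hk' h3 =>
      have := hk'.nonneg
      -- A smaller leading exponent gives a sum below 3 ^ n / 2, a larger one a sum of at least 3 ^
      -- (n + 1); both miss the window.
      rcases lt_trichotomy m n with hmn | rfl | hmn
      · have := pow_le_of_lt hmn
        omega
      · obtain rfl : k = k' := by omega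
        exact ⟨hq, hk'⟩
      · have := pow_le_of_lt hmn
        omega
  · rintro ⟨hq, hk⟩
    exact step hq hk (hk.two_mul_lt h2)

/-- With ternary digits 0 and 1, adding 3 ^ n causes no carry, so n is an exponent of the larger
sum. Exponents of k above n are stripped by induction. -/
theorem lt_of_add_pow (h : ChainSum q c k) {n : ℕ} (h' : ChainSum q c (k + 3 ^ n)) : q n < c := by
  have hpos : (0 : ℤ) < 3 ^ n := by positivity
  induction h with
  | @zero c _ =>
    rw [add_comm, pow_add_iff (by omega) (by omega)] at h'
    exact h'.1
  | @step c m k hq hk h2 ih =>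
    have hk0 := hk.nonneg
    rcases lt_trichotomy m n with hmn | rfl | hmn
    · have := pow_le_of_lt hmn
      have : (0 : ℤ) < 3 ^ m := by positivity
      rw [add_comm, pow_add_iff (by omega) (by omega)] at h'
      exact h'.1
    · have h3 := h'.two_mul_lt (n := m + 1) (by rw [pow_succ]; omega)
      rw [pow_succ] at h3
      omega
    · have := pow_le_of_lt hmn
      rw [add_assoc, pow_add_iff (by omega) (by omega)] at h'
      exact (ih h'.2).trans hq

end ChainSum

/-! ### Recurrence of local patterns. -/

variable {W : Type*} [LinearOrder W] [OrderBot W]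

/-- The chain sums below `p.1` around `p.2` agree with those below `p'.1` around `p'.2` up to
distance `r`. -/
def Agree (q : ℕ → W) (r : ℤ) (p p' : W × ℤ) : Prop :=
  ∀ k, |k| ≤ r → (ChainSum q p.1 (p.2 + k) ↔ ChainSum q p'.1 (p'.2 + k))

namespace Agree

variable {q : ℕ → W} {r : ℤ} {p p' p'' : W × ℤ}

theorem refl (q : ℕ → W) (r : ℤ) (p : W × ℤ) : Agree q r p p := fun _ _ => Iff.rfl

theorem trans (h : Agree q r p p') (h' : Agree q r p' p'') : Agree q r p p'' :=
  fun k hk => (h k hk).trans (h' k hk)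

theorem mono (h : Agree q r p p') {r' : ℤ} (hr : r' ≤ r) : Agree q r' p p' :=
  fun k hk => h k (hk.trans hr)

theorem shift (h : Agree q r p p') {r' j : ℤ} (hr : r' + |j| ≤ r) :
    Agree q r' (p.1, p.2 + j) (p'.1, p'.2 + j) := fun k hk => by
  simp only [add_assoc]
  exact h (j + k) ((abs_add_le j k).trans (by linarith))

theorem pow_add {n : ℕ} {c : W} {j : ℤ} (hc : q n < c) (h1 : -3 ^ n < 2 * (j - r))
    (h2 : j + r < 3 ^ n) : Agree q r (c, 3 ^ n + j) (q n, j) := fun k hk => by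
  have := abs_le.1 hk
  simp only [add_assoc]
  rw [ChainSum.pow_add_iff (by omega) (by omega)]
  simp [hc]

/-- Every occurrence of a chain sum either looks like one below some `c' < c₀`, or lies within a
bounded distance of a position that looks like the origin below `c₀`. -/
theorem exists_near {c₀ : W} {n₀ s : ℕ} (hn₀ : q n₀ = c₀) (hs : n₀ < s) {m ρ : ℤ} (_hm0 : 0 ≤ m)
    (_hρ0 : 0 ≤ ρ) (hm : 2 * m < 3 ^ n₀) (hρ : 2 * ρ < 3 ^ s) {c : W} {i : ℤ}
    (h : ChainSum q c i) :
    (∃ c' < c₀, ∃ j, Agree q ρ (c, i) (c', j)) ∨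
      ∃ j, 0 ≤ j ∧ j ≤ i + 3 ^ n₀ ∧ i ≤ j + 3 ^ s ∧ Agree q m (c, j) (c₀, 0) := by
  have hpos : (0 : ℤ) < 3 ^ n₀ := by positivity
  have hlt := ChainSum.pow_le_of_lt hs
  -- Near the start of a row above c₀, the position 3 ^ n₀ serves as a copy of the origin of row c₀,
  -- because q n₀ = c₀.
  have base {c : W} {i : ℤ} (hi0 : 0 ≤ i) (hi : i ≤ 3 ^ s) :
      (∃ c' < c₀, ∃ j, Agree q ρ (c, i) (c', j)) ∨
      ∃ j, 0 ≤ j ∧ j ≤ i + 3 ^ n₀ ∧ i ≤ j + 3 ^ s ∧ Agree q m (c, j) (c₀, 0) := by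
    rcases lt_trichotomy c c₀ with hc | rfl | hc
    · exact Or.inl ⟨c, hc, i, refl _ _ _⟩
    · exact Or.inr ⟨0, le_rfl, by omega, by omega, refl _ _ _⟩
    · refine Or.inr ⟨3 ^ n₀, by omega, by omega, by omega, ?_⟩
      subst hn₀
      simpa using pow_add (j := 0) (r := m) hc (by omega) (by omega)
  induction h with
  | zero _ => exact base le_rfl (by positivity)
  | @step c n k hq hk h2 ih =>
    have hk0 := hk.nonneg
    rcases lt_or_ge n s with hn | hn
    · have := ChainSum.pow_le_of_lt hn
      exact base (by positivity) (by omega)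
    -- A large leading power can be removed: the windows agree with those of row q n, where
    -- induction applies.
    · have : (3 : ℤ) ^ s ≤ 3 ^ n := pow_le_pow_right₀ (by norm_num) hn
      rcases ih with ⟨c', hc', j, hj⟩ | ⟨j, hj0, hj1, hj2, hj⟩
      · exact Or.inl ⟨c', hc', j, (pow_add hq (by omega) (by omega)).trans hj⟩
      · exact Or.inr ⟨3 ^ n + j, by positivity, by omega, by omega,
          (pow_add hq (by omega) (by omega)).trans hj⟩

/-- A position that does not look like any position below some `c' < c₀` lies within a bounded
distance of a position that looks like the origin below `c₀`. -/
theorem exists_bound {c₀ : W} (hc₀ : ∀ N, ∃ n ≥ N, q n = c₀) (m r : ℤ) :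
    ∃ R : ℤ, ∀ p : W × ℤ, (∀ p' : W × ℤ, p'.1 < c₀ → ¬ Agree q r p p') →
      ∃ k, |k| ≤ R ∧ Agree q m (p.1, p.2 + k) (c₀, 0) := by
  obtain ⟨l, hlm, hlr, hl0⟩ : ∃ l : ℤ, m ≤ l ∧ r ≤ l ∧ 0 ≤ l :=
    ⟨max 0 (max m r), by simp, by simp, by simp⟩
  have hpow (a : ℤ) (n : ℕ) (h : a.toNat ≤ n) : a < 3 ^ n := by
    have h1 : n < 3 ^ n := Nat.lt_pow_self (by norm_num)
    have h2 : (n : ℤ) < 3 ^ n := by exact_mod_cast h1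
    omega
  obtain ⟨n₀, hn₀, hq⟩ := hc₀ (2 * l).toNat
  set s := max (n₀ + 1) (2 * (2 * l)).toNat with hs
  have h1 := hpow _ _ hn₀
  have h2 := hpow (2 * (2 * l)) s (le_max_right _ _)
  have hpos : (0 : ℤ) < 3 ^ n₀ := by positivity
  have hpos' : (0 : ℤ) < 3 ^ s := by positivity
  -- Radius 2 * l was used for s because a window centred at a chain sum within l of p must still
  -- contain the radius l window of p.
  refine ⟨3 ^ s + 3 ^ n₀ + l, fun p hp => ?_⟩
  by_cases hz : ∃ k, |k| ≤ l ∧ ChainSum q p.1 (p.2 + k)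
  · obtain ⟨k, hk, hck⟩ := hz
    have hk' := abs_le.1 hk
    rcases exists_near hq (lt_of_lt_of_le (Nat.lt_add_one n₀) (le_max_left _ _) : n₀ < s) hl0
      (by omega) h1 h2 hck with ⟨c', hc', j, hj⟩ | ⟨j, hj0, hj1, hj2, hj⟩
    · refine absurd ?_ (hp (c', j - k) hc')
      have := hj.shift (r' := r) (j := -k) (by rw [abs_neg]; omega)
      simpa [sub_eq_add_neg] using this
    · refine ⟨j - p.2, abs_le.2 ⟨by omega, by omega⟩, ?_⟩
      simpa using hj.mono hlm
  · push Not at hz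
    -- A window without chain sums looks like row ⊥, which has none.
    rcases eq_bot_or_bot_lt c₀ with rfl | hc
    · refine ⟨0, by simp; omega, fun k hk => ?_⟩
      simp only [add_zero]
      exact iff_of_false (hz k (hk.trans hlm)) fun h => lt_irrefl _ h.bot_lt
    · refine absurd (fun k hk => ?_) (hp (⊥, 0) hc)
      exact iff_of_false (hz k (hk.trans hlr)) fun h => lt_irrefl _ h.bot_lt

end Agree

/-! ### Nonabelian simple groups and the lamp group. -/

open scoped commutatorElement

section SimpleGroup

variable {S : Type*} [Group S] [IsSimpleGroup S]

theorem Subgroup.eq_top_of_commutator_mem (hS : ∃ a b : S, a * b ≠ b * a) {T : Subgroup S}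
    (hT : ∀ a b : S, ⁅a, b⁆ ∈ T) : T = ⊤ := by
  have h : _root_.commutator S ≤ T := Subgroup.commutator_le.2 fun a _ b _ => hT a b
  rcases (inferInstance : (_root_.commutator S).Normal).eq_bot_or_eq_top with h' | h'
  · obtain ⟨a, b, hab⟩ := hS
    have : ⁅a, b⁆ ∈ _root_.commutator S := Subgroup.commutator_mem_commutator trivial trivial
    rw [h', Subgroup.mem_bot, commutatorElement_eq_one_iff_mul_comm] at this
    exact absurd this hab
  · exact top_le_iff.1 (h' ▸ h)

theorem exists_commutator_ne_one (hS : ∃ a b : S, a * b ≠ b * a) {u : S} (hu : u ≠ 1) :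
    ∃ s : S, ⁅u, s⁆ ≠ 1 := by
  by_contra! h
  have hc : u ∈ Subgroup.center S := by
    rw [Subgroup.mem_center_iff]
    exact fun g => (commutatorElement_eq_one_iff_mul_comm.1 (h g)).symm
  rcases (inferInstance : (Subgroup.center S).Normal).eq_bot_or_eq_top with h' | h'
  · rw [h', Subgroup.mem_bot] at hc
    exact hu hc
  · obtain ⟨a, b, hab⟩ := hS
    have hb : b ∈ Subgroup.center S := h' ▸ trivial
    exact hab (Subgroup.mem_center_iff.1 hb a)

end SimpleGroup

/-- The action of the integers on the functions `W × ℤ → S` by translation. -/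
def shiftAut (W S : Type*) [Group S] : Multiplicative ℤ →* MulAut (W × ℤ → S) where
  toFun t :=
    { toFun := fun f p => f (p.1, p.2 + t.toAdd)
      invFun := fun f p => f (p.1, p.2 - t.toAdd)
      left_inv := fun f => by simp
      right_inv := fun f => by simp
      map_mul' := fun f g => rfl }
  map_one' := by ext f p; simp
  map_mul' t u := by ext f p; simp [add_assoc]

@[simp] theorem shiftAut_apply {W S : Type*} [Group S] (t : Multiplicative ℤ) (f : W × ℤ → S)
    (p : W × ℤ) : shiftAut W S t f p = f (p.1, p.2 + t.toAdd) := rfl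

/-- The group of lamp configurations `W × ℤ → S` together with the translations. -/
abbrev Lamp (W S : Type*) [Group S] : Type _ := (W × ℤ → S) ⋊[shiftAut W S] Multiplicative ℤ

namespace Lamp

open SemidirectProduct

variable {W S : Type*} [Group S]

/-- The configuration with value `s` on `V` and `1` elsewhere. -/
noncomputable def cst (V : Set (W × ℤ)) : S →* Lamp W S :=
  (inl (φ := shiftAut W S)).comp
    { toFun := fun s => V.mulIndicator fun _ => s
      map_one' := Set.mulIndicator_one _ _
      map_mul' := fun _ _ => Set.mulIndicator_mul _ _ _ }

theorem cst_apply (V : Set (W × ℤ)) (s : S) :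
    cst V s = inl (φ := shiftAut W S) (V.mulIndicator fun _ => s) := rfl

/-- `K` contains all configurations that are constant on `V` and trivial elsewhere. -/
def Full (K : Subgroup (Lamp W S)) (V : Set (W × ℤ)) : Prop := ∀ s : S, cst V s ∈ K

/-- `K` is a normal subgroup of `G`. -/
structure NormalIn (G K : Subgroup (Lamp W S)) : Prop where
  le : K ≤ G
  conj_mem : ∀ g ∈ G, ∀ x ∈ K, g * x * g⁻¹ ∈ K

theorem NormalIn.refl (G : Subgroup (Lamp W S)) : NormalIn G G :=
  ⟨le_rfl, fun _ hg _ hx => G.mul_mem (G.mul_mem hg hx) (G.inv_mem hg)⟩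

theorem NormalIn.commutator_mem {G K : Subgroup (Lamp W S)} (hK : NormalIn G K) {g x : Lamp W S}
    (hx : x ∈ K) (hg : g ∈ G) : ⁅x, g⁆ ∈ K := by
  have := K.mul_mem hx (hK.conj_mem g hg _ (K.inv_mem hx))
  rwa [commutatorElement_def, mul_assoc x, mul_assoc x]

theorem inl_shiftAut (t : ℤ) (f : W × ℤ → S) :
    (inl (fun p => f (p.1, p.2 + t)) : Lamp W S) =
      inr (.ofAdd t) * inl f * (inr (.ofAdd t))⁻¹ := by
  rw [← map_inv, ← inl_aut]
  rfl

theorem commutator_cst (V : Set (W × ℤ)) {f : W × ℤ → S} {u : S} (hf : ∀ p ∈ V, f p = u) (s : S) :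
    ⁅(inl f : Lamp W S), cst V s⁆ = cst V ⁅u, s⁆ := by
  rw [cst_apply, cst_apply, ← map_commutatorElement]
  congr 1
  ext p
  by_cases hp : p ∈ V <;> simp [commutatorElement_def, hp, hf p]

theorem commutator_cst_cst (V V' : Set (W × ℤ)) (a b : S) :
    ⁅(cst V a : Lamp W S), cst V' b⁆ = cst (V ∩ V') ⁅a, b⁆ := by
  simp only [cst_apply, ← map_commutatorElement]
  congr 1
  ext p
  by_cases hp : p ∈ V <;> by_cases hp' : p ∈ V' <;> simp [commutatorElement_def, hp, hp']

section Full

variable {G K : Subgroup (Lamp W S)} {V V' : Set (W × ℤ)}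

theorem Full.mono (h : Full K V) (hKG : K ≤ G) : Full G V := fun s => hKG (h s)

theorem full_empty (K : Subgroup (Lamp W S)) : Full K ∅ := fun s => by
  rw [cst_apply, Set.mulIndicator_empty]
  exact K.one_mem

/-- Commutators of configurations constant on V and on V' live on the intersection, and S is
perfect. -/
theorem Full.inter [IsSimpleGroup S] (hS : ∃ a b : S, a * b ≠ b * a) (hK : NormalIn G K)
    (hV : Full K V) (hV' : Full G V') : Full K (V ∩ V') := by
  have : K.comap (cst (V ∩ V')) = ⊤ := Subgroup.eq_top_of_commutator_mem hS fun a b => by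
    rw [Subgroup.mem_comap, ← commutator_cst_cst]
    exact hK.commutator_mem (hV a) (hV' b)
  intro s
  rw [← Subgroup.mem_comap, this]
  trivial

theorem Full.compl (hV : Full G V) (h1 : Full G Set.univ) : Full G Vᶜ := fun s => by
  have : (cst Vᶜ s : Lamp W S) = cst Set.univ s * (cst V s)⁻¹ := by
    simp only [cst_apply, ← map_inv, ← map_mul]
    congr 1
    ext p
    by_cases hp : p ∈ V <;> simp [hp]
  rw [this]
  exact G.mul_mem (h1 s) (G.inv_mem (hV s))

theorem Full.union [IsSimpleGroup S] (hS : ∃ a b : S, a * b ≠ b * a) (hK : NormalIn G K)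
    (hV : Full K V) (hV' : Full K V') (h1 : Full G Set.univ) : Full K (V ∪ V') := fun s => by
  have : (cst (V ∪ V') s : Lamp W S) = cst V s * cst (V' ∩ Vᶜ) s := by
    simp only [cst_apply, ← map_mul]
    congr 1
    ext p
    by_cases hp : p ∈ V <;> by_cases hp' : p ∈ V' <;> simp [hp, hp']
  rw [this]
  exact K.mul_mem (hV s) (Full.inter hS hK hV' ((hV.mono hK.le).compl h1) s)

theorem Full.shift (hV : Full K V) (hK : NormalIn G K) (ht : ∀ t, inr t ∈ G) (k : ℤ) :
    Full K {p | (p.1, p.2 + k) ∈ V} := fun s => by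
  have := hK.conj_mem _ (ht (.ofAdd k)) _ (hV s)
  rw [cst_apply, ← inl_shiftAut] at this
  exact this

/-- The values s with `cst V s` in K form a normal subgroup of S. It contains some ⁅u, s⁆ ≠ 1, as u
is not central, so it is all of S. -/
theorem full_of_ne_one [IsSimpleGroup S] (hS : ∃ a b : S, a * b ≠ b * a) (hK : NormalIn G K)
    (hV : Full G V) {f : W × ℤ → S} (hf : inl f ∈ K) {u : S} (hu : u ≠ 1)
    (hfu : ∀ p ∈ V, f p = u) : Full K V := by
  obtain ⟨s, hs⟩ := exists_commutator_ne_one hS hu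
  have hn : (K.comap (cst V)).Normal := ⟨fun a ha g => by
    rw [Subgroup.mem_comap, map_mul, map_mul, map_inv]
    exact hK.conj_mem _ (hV g) _ ha⟩
  have hmem : ⁅u, s⁆ ∈ K.comap (cst V) := by
    rw [Subgroup.mem_comap, ← commutator_cst V hfu]
    exact hK.commutator_mem hf (hV s)
  intro v
  rcases hn.eq_bot_or_eq_top with h | h
  · rw [h, Subgroup.mem_bot] at hmem
    exact absurd hmem hs
  · rw [← Subgroup.mem_comap, h]
    trivial

end Full

section TrivialUpTo

variable [LinearOrder W]

/-- The configurations that are trivial at and below `w`. -/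
def trivialUpTo (S : Type*) [Group S] (w : W) : Subgroup (Lamp W S) where
  carrier := {e | e.right = 1 ∧ ∀ p : W × ℤ, p.1 ≤ w → e.left p = 1}
  one_mem' := ⟨rfl, fun _ _ => rfl⟩
  mul_mem' := by
    rintro a b ⟨ha, ha'⟩ ⟨hb, hb'⟩
    refine ⟨by simp [ha, hb], fun p hp => ?_⟩
    simp [ha' p hp, hb' (p.1, p.2 + a.right.toAdd) hp]
  inv_mem' := by
    rintro a ⟨ha, ha'⟩
    refine ⟨by simp [ha], fun p hp => ?_⟩
    simp [ha, ha' p hp]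

instance (w : W) : (trivialUpTo S w).Normal where
  conj_mem a ha g := by
    obtain ⟨ha, ha'⟩ := ha
    refine ⟨by simp [ha], fun p hp => ?_⟩
    simp [ha, ha' (p.1, p.2 + g.right.toAdd) hp]

theorem trivialUpTo_antitone {w w' : W} (h : w ≤ w') : trivialUpTo S w' ≤ trivialUpTo S w :=
  fun _ he => ⟨he.1, fun p hp => he.2 p (hp.trans h)⟩

end TrivialUpTo

/-! ### The finitely generated group and its normal subgroups. -/

section Chain

variable [LinearOrder W] [OrderBot W]

/-- The set of chain sums. -/
def chainSet (q : ℕ → W) : Set (W × ℤ) := {p | ChainSum q p.1 p.2}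

/-- The images of the generators of `chainGroup`. -/
noncomputable def gen (S : Type*) [Group S] (q : ℕ → W) : Option (S ⊕ S) → Lamp W S
  | none => inr (.ofAdd 1)
  | some (.inl s) => cst Set.univ s
  | some (.inr s) => cst (chainSet q) s

/-- The group generated by the translation, the constant configurations, and the configurations
that are constant on the set of chain sums and trivial elsewhere. -/
noncomputable def chainGroup (S : Type*) [Group S] (q : ℕ → W) : Subgroup (Lamp W S) :=
  Subgroup.closure (Set.range (gen S q))

variable {q : ℕ → W}

theorem gen_mem (i : Option (S ⊕ S)) : gen S q i ∈ chainGroup S q :=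
  Subgroup.subset_closure ⟨i, rfl⟩

theorem inr_mem (t : Multiplicative ℤ) : inr t ∈ chainGroup S q := by
  have h := (chainGroup S q).zpow_mem (gen_mem (S := S) (q := q) none) t.toAdd
  rw [gen, ← map_zpow, ← ofAdd_zsmul] at h
  simpa using h

theorem full_univ : Full (chainGroup S q) Set.univ := fun s => gen_mem (some (.inl s))

theorem full_chainSet : Full (chainGroup S q) (chainSet q) := fun s => gen_mem (some (.inr s))

/-- Prescribing a finite window is a finite intersection of translates of the chain set and of their
complements. -/
theorem full_agree [IsSimpleGroup S] (hS : ∃ a b : S, a * b ≠ b * a) (m : ℤ) (p' : W × ℤ) :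
    Full (chainGroup S q) {p | Agree q m p p'} := by
  have hfin (F : Finset ℤ) : Full (chainGroup S q)
      {p | ∀ k ∈ F, (ChainSum q p.1 (p.2 + k) ↔ ChainSum q p'.1 (p'.2 + k))} := by
    induction F using Finset.induction_on with
    | empty => simpa using full_univ
    | insert k F _ ih =>
      simp only [Finset.forall_mem_insert, Set.ofPred_and]
      refine Full.inter hS (NormalIn.refl _) ?_ ih
      have hk : Full (chainGroup S q) {p | ChainSum q p.1 (p.2 + k)} :=
        full_chainSet.shift (NormalIn.refl _) inr_mem k
      by_cases h : ChainSum q p'.1 (p'.2 + k)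
      · simpa [h] using hk
      · simpa [h, Set.compl_ofPred] using hk.compl full_univ
  simpa [Agree, abs_le, and_imp] using hfin (Finset.Icc (-m) m)

/-- Group elements are local rules: generators have radius 0, and the translations in products and
inverses enlarge it by a finite amount. -/
theorem exists_radius {e : Lamp W S} (he : e ∈ chainGroup S q) :
    ∃ r, ∀ p p', Agree q r p p' → e.left p = e.left p' := by
  induction he using Subgroup.closure_induction with
  | mem e he =>
    obtain ⟨i, rfl⟩ := he
    refine ⟨0, fun p p' h => ?_⟩
    have h0 := h 0 (by simp)
    rw [add_zero, add_zero] at h0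
    rcases i with _ | s | s
    · rfl
    · simp [gen, cst_apply]
    · by_cases hp : ChainSum q p.1 p.2
      · simp [gen, cst_apply, Set.mulIndicator, chainSet, hp, h0.1 hp]
      · simp [gen, cst_apply, Set.mulIndicator, chainSet, hp, mt h0.2 hp]
  | one => exact ⟨0, fun p p' _ => rfl⟩
  | mul a b _ _ iha ihb =>
    obtain ⟨r, hr⟩ := iha
    obtain ⟨r', hr'⟩ := ihb
    refine ⟨max r (r' + |a.right.toAdd|), fun p p' h => ?_⟩
    simp only [mul_left, Pi.mul_apply, shiftAut_apply]
    rw [hr p p' (h.mono (le_max_left _ _)), hr' _ _ (h.shift (le_max_right _ _))]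
  | inv a _ iha =>
    obtain ⟨r, hr⟩ := iha
    refine ⟨r + |a.right⁻¹.toAdd|, fun p p' h => ?_⟩
    simp only [inv_left, Pi.inv_apply, shiftAut_apply]
    rw [hr _ _ (h.shift le_rfl)]

/-- Cutting to V commutes with products up to translating V, and `Full` is stable under translation,
so only generators matter; there `Full.inter` applies. -/
theorem mulIndicator_mem [IsSimpleGroup S] (hS : ∃ a b : S, a * b ≠ b * a)
    {K : Subgroup (Lamp W S)} (hK : NormalIn (chainGroup S q) K) {e : Lamp W S}
    (he : e ∈ chainGroup S q) {V : Set (W × ℤ)} (hV : Full K V) :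
    inl (V.mulIndicator e.left) ∈ K := by
  have hshift (f : W × ℤ → S) (t : ℤ)
      (h : ∀ {V : Set (W × ℤ)}, Full K V → inl (V.mulIndicator f) ∈ K)
      {V : Set (W × ℤ)} (hV : Full K V) :
      inl (V.mulIndicator fun p => f (p.1, p.2 + t)) ∈ K := by
    have := hK.conj_mem _ (inr_mem (.ofAdd t)) _ (h (hV.shift hK inr_mem (-t)))
    rw [← inl_shiftAut] at this
    convert this using 2
    ext p
    have hp : (p.1, p.2 + t + -t) = p := by ext <;> simp
    have hiff : (p.1, p.2 + t) ∈ {p | (p.1, p.2 + -t) ∈ V} ↔ p ∈ V := by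
      rw [Set.mem_ofPred_eq, hp]
    by_cases hpV : p ∈ V
    · rw [Set.mulIndicator_of_mem hpV, Set.mulIndicator_of_mem (hiff.2 hpV)]
    · rw [Set.mulIndicator_of_notMem hpV, Set.mulIndicator_of_notMem (mt hiff.1 hpV)]
  induction he using Subgroup.closure_induction generalizing V with
  | mem e he =>
    obtain ⟨i, rfl⟩ := he
    rcases i with _ | s | s
    · simp [gen, K.one_mem]
    · simpa [gen, cst_apply] using hV s
    · simpa [gen, cst_apply, Set.mulIndicator_mulIndicator] using
        Full.inter hS hK hV full_chainSet s
  | one => simp [K.one_mem]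
  | mul a b _ _ iha ihb =>
    have : (a * b).left = a.left * fun p => b.left (p.1, p.2 + a.right.toAdd) := rfl
    rw [this, Set.mulIndicator_mul', map_mul]
    exact K.mul_mem (iha hV) (hshift _ _ ihb hV)
  | inv a _ iha =>
    have : a⁻¹.left = fun p => a.left⁻¹ (p.1, p.2 + a.right⁻¹.toAdd) := rfl
    rw [this]
    refine hshift _ _ (fun hV => ?_) hV
    rw [Set.mulIndicator_inv', map_inv]
    exact K.inv_mem (iha hV)

/-- A normal subgroup that is nontrivial over `c₀` contains all configurations that are trivial
below `c₀`. -/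
theorem inl_mem_of_trivial_below [IsSimpleGroup S] (hS : ∃ a b : S, a * b ≠ b * a)
    {K : Subgroup (Lamp W S)} (hK : NormalIn (chainGroup S q) K) {c₀ : W}
    (hc₀ : ∀ N, ∃ n ≥ N, q n = c₀) {g : W × ℤ → S} (hg : inl g ∈ K) {k : ℤ}
    (hgk : g (c₀, k) ≠ 1) {f : W × ℤ → S} (hf : inl f ∈ chainGroup S q)
    (hf1 : ∀ p : W × ℤ, p.1 < c₀ → f p = 1) : inl f ∈ K := by
  obtain ⟨r, hr⟩ := exists_radius (hK.le hg)
  obtain ⟨r', hr'⟩ := exists_radius hf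
  simp only [left_inl] at hr hr'
  -- After translation by k, g takes the single value g (c₀, k) ≠ 1 at every copy of the origin of
  -- row c₀, since its radius r window lies within r + |k|.
  have hV : Full K {p | Agree q (r + |k|) p (c₀, 0)} := by
    have hg' := hK.conj_mem _ (inr_mem (.ofAdd k)) _ hg
    rw [← inl_shiftAut] at hg'
    refine full_of_ne_one hS hK (full_agree hS _ _) hg' hgk fun p hp => ?_
    simpa using hr _ _ (Agree.shift hp le_rfl)
  obtain ⟨R, hR⟩ := Agree.exists_bound hc₀ (r + |k|) r'
  have hU (F : Finset ℤ) :
      Full K {p | ∃ j ∈ F, Agree q (r + |k|) (p.1, p.2 + j) (c₀, 0)} := by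
    induction F using Finset.induction_on with
    | empty => simpa using full_empty K
    | insert j F _ ih =>
      simp only [Finset.exists_mem_insert, Set.ofPred_or]
      exact Full.union hS hK (hV.shift hK inr_mem j) ih full_univ
  -- Where f is nontrivial, the window cannot look like a row below c₀, so a copy of the origin is
  -- within R. Thus f is supported on finitely many translates of those copies.
  have hmem := mulIndicator_mem hS hK hf (hU (Finset.Icc (-R) R))
  rwa [left_inl, Set.mulIndicator_eq_self.2] at hmem
  intro p hp
  obtain ⟨j, hj, hj'⟩ := hR p fun p' hp' h => hp (by rw [hr' p p' h, hf1 p' hp'])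
  exact ⟨j, by simpa [abs_le] using hj, hj'⟩

instance : WellFoundedGT (Subgroup (Multiplicative ℤ)) := by
  have e : Subgroup (Multiplicative ℤ) ≃o Submodule ℤ ℤ :=
    Subgroup.toAddSubgroup'.trans AddSubgroup.toIntSubmodule
  exact e.strictMono.wellFoundedGT

/-- The ascending chain condition on the normal subgroups of `chainGroup S q`. -/
theorem chain_stabilizes [IsSimpleGroup S] [WellFoundedLT W] (hS : ∃ a b : S, a * b ≠ b * a)
    (hq : ∀ c N, ∃ n ≥ N, q n = c) {K : ℕ → Subgroup (Lamp W S)}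
    (hK : ∀ n, NormalIn (chainGroup S q) (K n)) (hmono : Monotone K) :
    ∃ n, ∀ m ≥ n, K m ≤ K n := by
  have h1 : ∃ n, ∀ m ≥ n, ∀ f : W × ℤ → S, inl f ∈ K m → inl f ∈ K n := by
    by_cases hne : ∃ c, ∃ n, ∃ f : W × ℤ → S, inl f ∈ K n ∧ ∃ k, f (c, k) ≠ 1
    · obtain ⟨c₀, ⟨n, g, hg, k, hgk⟩, hmin⟩ := WellFounded.has_min wellFounded_lt
        {c | ∃ n, ∃ f : W × ℤ → S, inl f ∈ K n ∧ ∃ k, f (c, k) ≠ 1} hne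
      refine ⟨n, fun m _ f hf => inl_mem_of_trivial_below hS (hK n) (hq c₀) hg hgk
        ((hK m).le hf) fun p hp => ?_⟩
      by_contra hfp
      exact hmin p.1 ⟨m, f, hf, p.2, hfp⟩ hp
    · push Not at hne
      refine ⟨0, fun m _ f hf => ?_⟩
      have : f = 1 := funext fun p => hne p.1 m f hf p.2
      rw [this, map_one]
      exact (K 0).one_mem
  obtain ⟨n₁, h1⟩ := h1
  obtain ⟨n₂, h2⟩ := WellFoundedGT.monotone_chain_condition
    (⟨fun n => (K n).map rightHom, fun a b h => Subgroup.map_mono (hmono h)⟩ :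
      ℕ →o Subgroup (Multiplicative ℤ))
  refine ⟨max n₁ n₂, fun m hm x hx => ?_⟩
  have hx2 : rightHom x ∈ (K n₂).map rightHom := by
    have : (K n₂).map rightHom = (K m).map rightHom := h2 m ((le_max_right _ _).trans hm)
    rw [this]
    exact ⟨x, hx, rfl⟩
  obtain ⟨y, hy, hyx⟩ := hx2
  have hy' : y ∈ K (max n₁ n₂) := hmono (le_max_right _ _) hy
  have hxy : x * y⁻¹ ∈ K m := (K m).mul_mem hx ((K m).inv_mem (hmono hm hy'))
  have heq : x * y⁻¹ = inl (x * y⁻¹).left := by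
    rw [rightHom_eq_right] at hyx
    ext1
    · rfl
    · simp [hyx]
  rw [heq] at hxy
  have := hmono (le_max_left n₁ n₂) (h1 m ((le_max_left _ _).trans hm) _ hxy)
  rw [← heq] at this
  simpa using (K (max n₁ n₂)).mul_mem this hy'

/-- The sets of pairs of chain sums at distance `3 ^ n` separate the subgroups `trivialUpTo`. -/
theorem exists_mem_trivialUpTo [IsSimpleGroup S] (hS : ∃ a b : S, a * b ≠ b * a)
    {w w' : W} (hlt : w < w') (hw : ⊥ < w) {n : ℕ} (hn : q n = w) :
    ∃ e ∈ chainGroup S q, e ∈ trivialUpTo S w ∧ e ∉ trivialUpTo S w' := by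
  obtain ⟨a, b, hab⟩ := hS
  have ha : a ≠ 1 := by
    rintro rfl
    simp at hab
  subst hn
  refine ⟨cst (chainSet q ∩ {p | (p.1, p.2 + 3 ^ n) ∈ chainSet q}) a,
    Full.inter ⟨a, b, hab⟩ (NormalIn.refl _) full_chainSet
      (full_chainSet.shift (NormalIn.refl _) inr_mem _) a, ⟨rfl, fun p hp => ?_⟩, fun h => ha ?_⟩
  · have hmem : p ∉ chainSet q ∩ {p | (p.1, p.2 + 3 ^ n) ∈ chainSet q} :=
      fun hmem => (ChainSum.lt_of_add_pow hmem.1 hmem.2).not_ge hp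
    simp [cst_apply, hmem]
  · have hmem : (w', (0 : ℤ)) ∈ chainSet q ∩ {p | (p.1, p.2 + 3 ^ n) ∈ chainSet q} := by
      refine ⟨ChainSum.zero (hw.trans hlt), ?_⟩
      have := ChainSum.step hlt (ChainSum.zero hw) (n := n) (by positivity)
      simpa [chainSet] using this
    rw [← h.2 (w', 0) le_rfl, cst_apply, left_inl, Set.mulIndicator_of_mem hmem]

end Chain

end Lamp

/-! ### Reduction from well-founded relations, and the conclusion. -/

theorem alternatingGroup_five_noncomm : ∃ a b : alternatingGroup (Fin 5), a * b ≠ b * a :=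
  ⟨⟨Equiv.swap 0 1 * Equiv.swap 1 2, by
    simp [Equiv.Perm.mem_alternatingGroup]⟩, ⟨Equiv.swap 0 1 * Equiv.swap 1 3, by
    simp [Equiv.Perm.mem_alternatingGroup]⟩,
    fun h => absurd (DFunLike.congr_fun (congrArg Subtype.val h) 0) (by decide)⟩

/-- A sequence hitting every point of a countable type infinitely often. -/
theorem exists_seq_hits (W : Type*) [Countable W] [Nonempty W] :
    ∃ q : ℕ → W, ∀ c N, ∃ n ≥ N, q n = c := by
  obtain ⟨f, hf⟩ := exists_surjective_nat (W × ℕ)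
  refine ⟨fun n => (f n).1, fun c N => ?_⟩
  by_contra! h
  choose n hn using fun k => hf (c, k)
  have hlt (k : ℕ) : n k < N := by
    by_contra! hk
    exact h _ hk (by rw [hn])
  have hinj : Function.Injective fun k => (⟨n k, hlt k⟩ : Fin N) := fun k l hkl => by
    have h1 : n k = n l := congrArg Fin.val hkl
    have h2 := hn k
    rw [h1, hn] at h2
    exact (congrArg Prod.snd h2).symm
  exact not_injective_infinite_finite _ hinj

theorem exists_freeGroup_hom {G ι : Type*} [Group G] [Finite ι] (u : ι → G) :
    ∃ φ : FreeGroup ℕ →* G, φ.range = Subgroup.closure (Set.range u) ∧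
      ∃ m ≥ 1, ∀ i, m ≤ i → φ (FreeGroup.of i) = 1 := by
  let e := Finite.equivFin ι
  let v (i : ℕ) : G := if h : i < Nat.card ι then u (e.symm ⟨i, h⟩) else 1
  refine ⟨FreeGroup.lift v, ?_, Nat.card ι + 1, by omega, fun i hi => ?_⟩
  · rw [FreeGroup.range_lift_eq_closure]
    refine le_antisymm ((Subgroup.closure_le _).2 ?_) (Subgroup.closure_mono ?_)
    · rintro _ ⟨i, rfl⟩
      by_cases h : i < Nat.card ι
      · rw [show v i = u (e.symm ⟨i, h⟩) from dif_pos h]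
        exact Subgroup.subset_closure ⟨_, rfl⟩
      · rw [show v i = 1 from dif_neg h]
        exact Subgroup.one_mem _
    · rintro _ ⟨j, rfl⟩
      exact ⟨e j, by simp [v]⟩
  · simp [v, show ¬ i < Nat.card ι by omega]

open Lamp in
/-- Every countable well-founded relation embeds, with order reversed, into the normal subgroups
of some finitely generated group with max-n. -/
theorem exists_maxN_of_wellFounded {ι : Type} [Countable ι] {r : ι → ι → Prop}
    (h : WellFounded r) : ∃ N ∈ maxNGroups ∩ MarkedGroup.fg, ∃ K : ι → MarkedGroup,
      (∀ j, N.ker ≤ (K j).ker) ∧ ∀ j i, r j i → (K i).ker < (K j).ker := by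
  let S := alternatingGroup (Fin 5)
  have hS : ∃ a b : S, a * b ≠ b * a := alternatingGroup_five_noncomm
  -- The added ⊥ keeps every w i off the row without chain sums, as `exists_mem_trivialUpTo`
  -- requires.
  let W := WithBot (Set.range fun i => (h.apply i).rank)
  have : Countable (Set.range fun i => (h.apply i).rank) := (Set.countable_range _).to_subtype
  have : Countable W := inferInstanceAs (Countable (Option _))
  obtain ⟨q, hq⟩ := exists_seq_hits W
  obtain ⟨φ, hφ, m, hm, hφm⟩ := exists_freeGroup_hom (gen S q)
  change φ.range = chainGroup S q at hφ
  have hmem (x : FreeGroup ℕ) : φ x ∈ chainGroup S q := hφ ▸ ⟨x, rfl⟩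
  let w (i : ι) : W := ((⟨_, i, rfl⟩ : Set.range fun i => (h.apply i).rank) : W)
  refine ⟨⟨φ.ker, inferInstance⟩, ⟨?_, ?_⟩,
    fun i => ⟨(trivialUpTo S (w i)).comap φ, inferInstance⟩, fun j x hx => ?_, fun j i hji => ?_⟩
  · rw [MarkedGroup.mem_maxNGroups_iff]
    rintro ⟨K, hK, hlt⟩
    have hmono : StrictMono fun n => (K n).ker := strictMono_nat_of_lt_succ hlt
    have hnorm (n : ℕ) : NormalIn (chainGroup S q) ((K n).ker.map φ) := by
      refine ⟨hφ ▸ Subgroup.map_le_range _ _, ?_⟩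
      rintro g hg _ ⟨x, hx, rfl⟩
      rw [← hφ] at hg
      obtain ⟨y, rfl⟩ := hg
      exact ⟨y * x * y⁻¹, (K n).normal.conj_mem x hx y, by simp⟩
    obtain ⟨n, hn⟩ := chain_stabilizes hS hq hnorm
      (fun a b hab => Subgroup.map_mono (hmono.monotone hab))
    refine (hlt n).not_ge ?_
    have := Subgroup.comap_mono (f := φ) (hn (n + 1) n.le_succ)
    rwa [Subgroup.comap_map_eq, Subgroup.comap_map_eq, sup_eq_left.2 (hK n),
      sup_eq_left.2 (hK (n + 1))] at this
  · exact Set.mem_biUnion hm fun i hi => hφm i hi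
  · have hx : φ x = 1 := hx
    simp only [Subgroup.mem_comap, hx]
    exact one_mem _
  · have hw : w j < w i := WithBot.coe_lt_coe.2 (Acc.rank_lt_of_rel (h.apply i) hji)
    refine lt_of_le_not_ge (Subgroup.comap_mono (trivialUpTo_antitone hw.le)) fun hle => ?_
    obtain ⟨n, -, hn⟩ := hq (w j) 0
    obtain ⟨e, he, he1, he2⟩ := exists_mem_trivialUpTo hS hw (WithBot.bot_lt_coe _) hn
    rw [← hφ] at he
    obtain ⟨x, rfl⟩ := he
    exact he2 (hle he1)

/-- Existence of a pair (N, K) characterizes well-foundedness: an infinite R-descending chain would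
give an ascending chain of normal subgroups above N, contradicting max-n. -/
theorem not_measurableSet_maxNGroups_inter_fg :
    ¬ MeasurableSet (maxNGroups ∩ MarkedGroup.fg) := by
  intro hM
  have : PolishSpace (List ℕ × List ℕ → Bool) := { }
  apply not_analyticSet_wellFounded
  have h : {R : List ℕ × List ℕ → Bool | WellFounded fun s t => R (s, t) = true} =
      Prod.fst '' {p : (List ℕ × List ℕ → Bool) × MarkedGroup × (List ℕ → MarkedGroup) |
        p.2.1 ∈ maxNGroups ∩ MarkedGroup.fg ∧
        (∀ j, p.2.1.ker ≤ (p.2.2 j).ker) ∧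
        ∀ j i, p.1 (j, i) ≠ true ∨ (p.2.2 i).ker < (p.2.2 j).ker} := by
    ext R
    constructor
    · intro hR
      obtain ⟨N, hN, K, hK, hlt⟩ := exists_maxN_of_wellFounded hR
      exact ⟨(R, N, K), ⟨hN, hK, fun j i => imp_iff_not_or.1 (hlt j i)⟩, rfl⟩
    · rintro ⟨⟨R, N, K⟩, ⟨hN, hK, hlt⟩, rfl⟩
      refine wellFounded_iff_isEmpty_descending_chain.2 ⟨fun ⟨s, hs⟩ => ?_⟩
      exact MarkedGroup.mem_maxNGroups_iff.1 hN.1 ⟨fun n => K (s n), fun n => hK _,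
        fun n => (hlt _ _).resolve_left (not_not.2 (hs n))⟩
  rw [h]
  refine AnalyticSet.image_of_continuous (MeasurableSet.analyticSet ?_) continuous_fst
  have hN : Measurable fun p :
    (List ℕ × List ℕ → Bool) × MarkedGroup × (List ℕ → MarkedGroup) => p.2.1 :=
    measurable_fst.comp measurable_snd
  have hK (j : List ℕ) : Measurable fun p :
    (List ℕ × List ℕ → Bool) × MarkedGroup × (List ℕ → MarkedGroup) => p.2.2 j :=
    (measurable_pi_apply j).comp (measurable_snd.comp measurable_snd)
  have hR (a : List ℕ × List ℕ) : MeasurableSet {p :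
    (List ℕ × List ℕ → Bool) × MarkedGroup × (List ℕ → MarkedGroup) | p.1 a = true} :=
    ((measurable_pi_apply (X := fun _ : List ℕ × List ℕ => Bool) a).comp
      (measurable_fst : Measurable fun p :
    (List ℕ × List ℕ → Bool) × MarkedGroup × (List ℕ → MarkedGroup) => p.1))
        (measurableSet_singleton true)
  simp only [Set.ofPred_and, Set.ofPred_forall, Set.ofPred_or]
  exact (hN hM).inter ((MeasurableSet.iInter fun j =>
    MarkedGroup.measurableSet_ker_le hN (hK j)).inter (MeasurableSet.iInter fun j =>
      MeasurableSet.iInter fun i => (hR (j, i)).compl.union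
        (MarkedGroup.measurableSet_ker_lt (hK i) (hK j))))

theorem mainTheorem7 :
    (IsPi11 maxNGroups ∧ ¬ MeasurableSet maxNGroups) ∧
    (IsPi11 maxNGroupsFg ∧ ¬ MeasurableSet maxNGroupsFg) ∧
    (∀ γ : ℕ → FreeGroup ℕ, Function.Surjective γ →
      (∀ N ∈ maxNGroups, MarkedGroup.length γ N < Ordinal.omega 1) ∧
      (∀ α < Ordinal.omega 1, ∃ N ∈ maxNGroups ∩ MarkedGroup.fg,
        α ≤ MarkedGroup.length γ N)) := by
  have hpi : IsPi11 maxNGroups := MarkedGroup.analyticSet_compl_maxNGroups.isSigma11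
  have hM := not_measurableSet_maxNGroups_inter_fg
  refine ⟨⟨hpi, fun h => hM (h.inter MarkedGroup.measurableSet_fg)⟩,
    ⟨IsSigma11.preimage hpi measurable_subtype_coe, fun h => hM ?_⟩, fun γ hγ =>
    ⟨fun N hN => MarkedGroup.length_lt_omega_one hγ hN, fun α hα =>
      MarkedGroup.exists_le_length hγ hM hα⟩⟩
  have := MarkedGroup.measurableSet_fg.subtype_image h
  have heq : maxNGroups ∩ MarkedGroup.fg = Subtype.val '' maxNGroupsFg := by
    rw [Set.inter_comm, ← Subtype.image_preimage_coe]
    rfl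
  rwa [heq]
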